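/- A $T$-query quantum network on a list $x\in\{0,1\}^N$ applies $U_T O_x U_{T-1} O_x\cdots O_x U_0$ to $|0\cdots 0\rangle$ on finitely many qubits, where the unitaries $U_0,\dots,U_T$ do not depend on $x$ and $O_x|j,b,z\rangle=|j,b\oplus x_j,z\rangle$ (with $x_j=0$ for $j\ge N$); the final state is then observed and an output is read off. The network searches with error at most $\varepsilon$ under the promise "$0$ or at least $t$ ones" if, for every $x$ with no ones or with at least $t$ ones, its output is correct with probability at least $1-\varepsilon$. Here the output is either only the answer to the question "does $x$ contain a one?", or a position $j$ with $x_j=1$ together with the possible answer "there are no ones"; the results below hold in both cases. (1) There are absolute constants $b,c>0$ such that, for all integers $N,t,T$ with $1\le t<N$ and $0\le T\le N-t$ and every real $\varepsilon$, if some $T$-query network searches lists of length $N$ with error at most $\varepsilon$ under the promise "$0$ or at least $t$ ones", then $$\varepsilon\ \ge\ c\,\exp\left(-\frac{4bT^2}{N-t}-8T\sqrt{\frac{tN}{(N-t)^2}}\right).$$ (2) Consequently, for every constant $\varepsilon<1/2$ and all integer sequences $t=t(N)\ge 1$ and $T=T(N)\ge 0$ with $t=o(N)$ and $T=o(\sqrt{N/t})$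 as $N\to\infty$, for all sufficiently large $N$ no $T(N)$-query network searches lists of length $N$ with error at most $\varepsilon$ under the promise "$0$ or at least $t(N)$ ones". -/

import Mathlib

open Filter Asymptotics

namespace QuantumQuery

/-- Classical basis states of the registers `|j, b, z⟩`: an index register of `n` qubits (read as a
number `j < 2 ^ n`), the query target qubit `b`, and a workspace `z` of `w` qubits. -/
abbrev BasisState (n w : ℕ) : Type := Fin (2 ^ n) × Bool × (Fin w → Bool)

/-- Superpositions, given by their amplitudes. -/
abbrev StateVec (n w : ℕ) : Type := BasisState n w → ℂ

/-- The bit `x_j` of the list; positions `j ≥ N` that the index register may name hold `0`. -/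
def listBit {N : ℕ} (x : Fin N → Bool) (j : ℕ) : Bool :=
  if h : j < N then x ⟨j, h⟩ else false

/-- The number of ones in the list. -/
def numOnes {N : ℕ} (x : Fin N → Bool) : ℕ :=
  (Finset.univ.filter (fun j => x j = true)).card

/-- The query gate `|j, b, z⟩ ↦ |j, b ⊕ x_j, z⟩`, extended linearly. The basis map is an involution,
so the new amplitude of `|j, b, z⟩` is the old amplitude of `|j, b ⊕ x_j, z⟩`. -/
def queryGate {N : ℕ} (x : Fin N → Bool) {n w : ℕ} (ψ : StateVec n w) : StateVec n w :=
  fun k => ψ (k.1, xor k.2.1 (listBit x (k.1 : ℕ)), k.2.2)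

/-- The all-zero basis state. -/
def zeroBasis (n w : ℕ) : BasisState n w :=
  (⟨0, Nat.two_pow_pos n⟩, false, fun _ => false)

/-- The initial state `|0…0⟩`. -/
def initState (n w : ℕ) : StateVec n w := Pi.single (zeroBasis n w) 1

/-- A quantum network with `T` queries to a list of `N` bits: unitaries `U 0, …, U T`, which do not
depend on the list, on finitely many qubits, whose index register can name all `N` positions. -/
structure QueryNetwork (N T : ℕ) where
  /-- number of qubits of the index register -/
  n : ℕ
  /-- number of qubits of the workspace -/
  w : ℕ
  index_le : N ≤ 2 ^ n
  U : Fin (T + 1) → Matrix.unitaryGroup (BasisState n w) ℂ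

namespace QueryNetwork

variable {N T : ℕ}

/-- The state `U_i O U_{i-1} O ⋯ O U_0 |0…0⟩` after `i` queries to the list `x`. -/
noncomputable def stateAfter (A : QueryNetwork N T) (x : Fin N → Bool) (i : Fin (T + 1)) :
    StateVec A.n A.w :=
  Fin.induction (motive := fun _ => StateVec A.n A.w)
    (Matrix.mulVec (A.U 0 : Matrix (BasisState A.n A.w) (BasisState A.n A.w) ℂ)
      (initState A.n A.w))
    (fun k ψ =>
      Matrix.mulVec (A.U k.succ : Matrix (BasisState A.n A.w) (BasisState A.n A.w) ℂ)
        (queryGate x ψ)) i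

/-- The final state `U_T O U_{T-1} O ⋯ O U_0 |0…0⟩`. -/
noncomputable def finalState (A : QueryNetwork N T) (x : Fin N → Bool) : StateVec A.n A.w :=
  A.stateAfter x (Fin.last T)

open Classical in
/-- The probability that observing the final state yields a basis state in `E`. -/
noncomputable def prob (A : QueryNetwork N T) (x : Fin N → Bool)
    (E : BasisState A.n A.w → Prop) : ℝ :=
  ∑ k with E k, ‖A.finalState x k‖ ^ 2

/-- The Boolean output `out` (for instance one specific qubit of the observed final state) tells
whether the list contains a one, with error probability at most `ε` on every list that has either
no ones or at least `t` ones. -/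
def DetectsWithError (A : QueryNetwork N T) (out : BasisState A.n A.w → Bool) (t : ℕ) (ε : ℝ) :
    Prop :=
  ∀ x : Fin N → Bool,
    (numOnes x = 0 → A.prob x (fun k => out k ≠ false) ≤ ε) ∧
    (t ≤ numOnes x → A.prob x (fun k => out k ≠ true) ≤ ε)

/-- The output `out` is a position of a one, or `none` for "there are no ones", and is right
with error probability at most `ε` on every list that has either no ones or at least `t` ones. -/
def FindsWithError (A : QueryNetwork N T) (out : BasisState A.n A.w → Option (Fin N)) (t : ℕ)
    (ε : ℝ) : Prop :=
  ∀ x : Fin N → Bool,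
    (numOnes x = 0 → A.prob x (fun k => out k ≠ none) ≤ ε) ∧
    (t ≤ numOnes x → A.prob x (fun k => ¬ ∃ j, out k = some j ∧ x j = true) ≤ ε)

end QueryNetwork

/-- Some `T`-query network decides whether a list of `N` bits contains a one, with error at most `ε`
whenever the list has no ones or at least `t` ones. -/
def DetectionAchievable (N t T : ℕ) (ε : ℝ) : Prop :=
  ∃ (A : QueryNetwork N T) (out : BasisState A.n A.w → Bool), A.DetectsWithError out t ε

/-- Some `T`-query network finds the position of a one in a list of `N` bits, or reports that there
is none, with error at most `ε` whenever the list has no ones or at least `t` ones. -/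
def FindingAchievable (N t T : ℕ) (ε : ℝ) : Prop :=
  ∃ (A : QueryNetwork N T) (out : BasisState A.n A.w → Option (Fin N)), A.FindsWithError out t ε

end QuantumQuery

namespace QuantumQuery

open Polynomial

/-! Each amplitude after `T` queries is a polynomial of degree at most `T` in the bits of `x`. Take
the overlap, restricted to the outcomes that report "no ones", of the final state on `x` with the
final state on the zero list. The second factor is constant in `x`, so the degree stays `T` instead
of doubling as it would for a probability. At the zero list the overlap is a probability `p ≥ 1 -
ε`; by Cauchy-Schwarz it is at most `√(p * ε)` in modulus once `x` has at least `t` ones. Averaging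
real parts over lists of weight `m` gives a real polynomial `P` of degree at most `T` with `P(0) =
p` and `|P(m)| ≤ √(p * ε)` for `t ≤ m ≤ N`.

It remains to bound `P(0)` (`abs_eval_zero_le`). With `n = N - t`, the expectation of `P(t + Bin(n,
u))` is a polynomial in `u`, bounded on `[0, 1]`, whose coefficients are the Newton coefficients of
`P` at `t` times falling factorials of `n`. V. Markov's inequality bounds them, and summing the
Newton series at `-t` gives an exponential factor. Squaring `p ≤ √(p * ε) * exp y` yields `1 - ε ≤ ε
* exp (2 * y)`, from which both claims follow. -/

/-! ### Polynomials bounded at consecutive integers -/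

theorem exists_newton_expansion (d : ℕ) (Q : ℝ[X]) (hQ : Q.natDegree ≤ d) :
    ∃ b : ℕ → ℝ, ∀ x : ℝ, Q.eval x =
      ∑ j ∈ Finset.range (d + 1), b j * ∏ l ∈ Finset.range j, (x - l) := by
  induction d generalizing Q with
  | zero =>
    refine ⟨fun _ => Q.coeff 0, fun x => ?_⟩
    rw [Polynomial.eq_C_of_natDegree_le_zero hQ]
    simp
  | succ d ih =>
    -- Since `Q(x) = Q(0) + x * R(x)`, expanding `R` in falling factorials of `x - 1` makes the
    -- extra factor `x` complete each of them.
    obtain ⟨b, hb⟩ := ih (Q.divX.comp (X + C 1)) (by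
      rw [natDegree_comp, natDegree_X_add_C, mul_one, natDegree_divX_eq_natDegree_tsub_one]
      omega)
    refine ⟨fun j => Nat.casesOn j (Q.coeff 0) b, fun x => ?_⟩
    have h := hb (x - 1)
    rw [eval_comp] at h
    simp only [eval_add, eval_X, eval_C, sub_add_cancel] at h
    rw [Finset.sum_range_succ']
    conv_lhs => rw [← divX_mul_X_add Q]
    simp only [eval_add, eval_mul, eval_X, eval_C, h, Finset.sum_mul]
    congr 1
    · refine Finset.sum_congr rfl fun j _ => ?_
      rw [Finset.prod_range_succ', Nat.cast_zero, sub_zero, mul_assoc]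
      congr 2
      refine Finset.prod_congr rfl fun l _ => ?_
      push_cast
      ring
    · simp

/-- Factorial moments of a binomial variable. They turn a Newton expansion into a power series in
`u`. -/
theorem sum_choose_mul_descFactorial (j n : ℕ) (u v : ℝ) (huv : u + v = 1) :
    ∑ i ∈ Finset.range (n + 1), (n.choose i : ℝ) * (∏ l ∈ Finset.range j, ((i : ℝ) - l)) *
      (u ^ i * v ^ (n - i)) = (∏ l ∈ Finset.range j, ((n : ℝ) - l)) * u ^ j := by
  induction j generalizing n with
  | zero =>
    have h := add_pow u v n
    rw [huv, one_pow] at h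
    simp only [Finset.range_zero, Finset.prod_empty, mul_one, pow_zero]
    rw [h]
    exact Finset.sum_congr rfl fun i _ => by ring
  | succ j ih =>
    cases n with
    | zero => simp [Finset.prod_range_succ']
    | succ n =>
      rw [Finset.sum_range_succ']
      have key : ∀ m : ℕ, ∏ l ∈ Finset.range (j + 1), (((m + 1 : ℕ) : ℝ) - l) =
          (m + 1) * ∏ l ∈ Finset.range j, ((m : ℝ) - l) := fun m => by
        rw [Finset.prod_range_succ', mul_comm]
        push_cast
        simp only [sub_zero, add_sub_add_right_eq_sub]
      have h0 : ∏ l ∈ Finset.range (j + 1), (((0 : ℕ) : ℝ) - l) = 0 := by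
        simp [Finset.prod_range_succ']
      rw [h0, key, mul_zero, zero_mul, add_zero, mul_assoc, pow_succ, ← mul_assoc _ _ u, ← ih n,
        Finset.sum_mul, Finset.mul_sum]
      refine Finset.sum_congr rfl fun i _ => ?_
      have hc : ((n : ℝ) + 1) * (n.choose i) = ((n + 1).choose (i + 1)) * ((i : ℝ) + 1) := by
        exact_mod_cast Nat.add_one_mul_choose_eq n i
      rw [key, Nat.add_sub_add_right, pow_succ]
      linear_combination (-(∏ l ∈ Finset.range j, ((i : ℝ) - l)) * (u ^ i * v ^ (n - i)) * u) * hc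

/-- V. Markov's bound for the coefficients of a polynomial bounded on `[0, 1]`. -/
theorem abs_coeff_le_of_abs_le_on_unit_interval (d : ℕ) (f : ℝ[X]) (hf : f.natDegree ≤ d)
    (M : ℝ) (hM : 0 < M) (hb : ∀ u ∈ Set.Icc (0 : ℝ) 1, |f.eval u| ≤ M) (j : ℕ) :
    |f.coeff j| ≤ M * ∏ l ∈ Finset.range j,
      (2 * ((d : ℝ) ^ 2 - (l : ℝ) ^ 2) / ((l + 1) * (2 * l + 1))) := by
  have main : ∀ s : ℝ, |s| = 1 → s * f.coeff j ≤ M * ∏ l ∈ Finset.range j,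
      (2 * ((d : ℝ) ^ 2 - (l : ℝ) ^ 2) / ((l + 1) * (2 * l + 1))) := by
    intro s hs
    -- The substitution `u = (1 - x) / 2` sends `x = 1` to `u = 0`, where the derivatives of `f`
    -- give its coefficients and the Chebyshev polynomial is extremal. The factor `(-1) ^ j` cancels
    -- the chain-rule sign; `s = ±1` gives both halves of the absolute value.
    set g : ℝ[X] := C (s * (-1) ^ j / M) * f.comp (C (1 / 2) - C (1 / 2) * X) with hg
    have hlin : (C (1 / 2) - C (1 / 2) * X : ℝ[X]).natDegree ≤ 1 := by compute_degree
    have hdeg : g.degree ≤ d := by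
      refine natDegree_le_iff_degree_le.mp ((natDegree_C_mul_le _ _).trans ?_)
      rw [natDegree_comp]
      calc _ ≤ d * 1 := Nat.mul_le_mul hf hlin
        _ = d := mul_one d
    have hbd : ∀ x ∈ Set.Icc (-1 : ℝ) 1, |g.eval x| ≤ 1 := by
      intro x hx
      have h1 : |s * (-1) ^ j / M| = 1 / M := by
        rw [abs_div, abs_mul, hs, abs_neg_one_pow, abs_of_pos hM, one_mul]
      rw [hg, eval_mul, eval_C, eval_comp, abs_mul, h1, one_div, inv_mul_le_iff₀ hM, mul_one]
      apply hb
      simp only [eval_sub, eval_mul, eval_C, eval_X, Set.mem_Icc] at hx ⊢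
      constructor <;> linarith [hx.1, hx.2]
    have h := Chebyshev.eval_iterate_derivative_le_of_forall_abs_le_one (k := j) le_rfl hdeg hbd
    have hder : ∀ k : ℕ, derivative^[k] (f.comp (C (1 / 2) - C (1 / 2) * X)) =
        C ((-1 / 2) ^ k) * (derivative^[k] f).comp (C (1 / 2) - C (1 / 2) * X) := by
      intro k
      induction k with
      | zero => simp
      | succ k ih =>
        rw [Function.iterate_succ_apply', ih, derivative_C_mul, derivative_comp,
          Function.iterate_succ_apply', pow_succ, C_mul, mul_assoc]
        congr 1
        rw [derivative_sub, derivative_C, derivative_C_mul, derivative_X, zero_sub, mul_one, ← C_neg,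
          neg_div]
    rw [hg, iterate_derivative_C_mul, hder, Chebyshev.iterate_derivative_T_eval_one_eq_div] at h
    simp only [eval_mul, eval_C, eval_comp, eval_sub, eval_X, mul_one, sub_self] at h
    have hc : (derivative^[j] f).eval 0 = j.factorial * f.coeff j := by
      rw [← coeff_zero_eq_eval_zero, coeff_iterate_derivative]
      simp [Nat.descFactorial_self]
    rw [hc] at h
    have hprod : (∏ l ∈ Finset.range j,
        (2 * ((d : ℝ) ^ 2 - (l : ℝ) ^ 2) / ((l + 1) * (2 * l + 1)))) =
        2 ^ j / j.factorial * ((∏ l ∈ Finset.range j, ((d : ℝ) ^ 2 - (l : ℝ) ^ 2)) /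
          ∏ l ∈ Finset.range j, (2 * (l : ℝ) + 1)) := by
      rw [Finset.prod_div_distrib, Finset.prod_mul_distrib, Finset.prod_mul_distrib,
        Finset.prod_const, Finset.card_range, ← Finset.prod_range_add_one_eq_factorial]
      push_cast
      rw [div_mul_div_comm]
    rw [hprod]
    push_cast at h
    have hsgn : ((-1 : ℝ) ^ j) * (-1) ^ j = 1 := by rw [← mul_pow]; simp
    have hfac : (0 : ℝ) < j.factorial := by positivity
    have hmul := mul_le_mul_of_nonneg_left h
      (show 0 ≤ M * 2 ^ j / (j.factorial : ℝ) by positivity)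
    calc s * f.coeff j = M * 2 ^ j / (j.factorial : ℝ) *
          (s * (-1) ^ j / M * ((-1 / 2) ^ j * (j.factorial * f.coeff j))) := by
          rw [div_pow]
          field_simp
          linear_combination (-(s * f.coeff j)) * hsgn
      _ ≤ _ := hmul
      _ = _ := by ring
  rw [abs_le']
  refine ⟨by simpa using main 1 (by simp), by simpa using main (-1) (by simp)⟩

/-- The products are dominated by the Cauchy product coefficients `c j` of the series `∑ s ^ (2 * i)
/ (2 * i)!` of `cosh s` and that of `exp a`. The recursion for `c` weights its terms by `s ^ 2 / (2
* (2 * i + 1))` with `i ≤ j`, which is smallest at `i = j`; this gives the required ratio. -/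
theorem sum_prod_le_exp (s a : ℝ) (hs : 0 ≤ s) (ha : 0 ≤ a) (d : ℕ) :
    ∑ j ∈ Finset.range (d + 1), ∏ l ∈ Finset.range j,
      (s ^ 2 / ((2 * l + 1) * (2 * l + 2)) + a / (l + 1)) ≤ Real.exp (s + a) := by
  set α : ℕ → ℝ := fun i => s ^ (2 * i) / (2 * i).factorial with hα
  set β : ℕ → ℝ := fun i => a ^ i / i.factorial with hβ
  have hα0 : ∀ i, 0 ≤ α i := fun i => by positivity
  have hβ0 : ∀ i, 0 ≤ β i := fun i => by positivity
  set c : ℕ → ℝ := fun j => ∑ p ∈ Finset.HasAntidiagonal.antidiagonal j, α p.1 * β p.2 with hcdef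
  have hαs : ∀ i : ℕ, ((i : ℝ) + 1) * α (i + 1) = s ^ 2 / (2 * (2 * i + 1)) * α i := fun i => by
    simp only [hα]
    rw [show 2 * (i + 1) = 2 * i + 1 + 1 by ring, Nat.factorial_succ, Nat.factorial_succ]
    push_cast
    field_simp
    ring
  have hβs : ∀ i : ℕ, ((i : ℝ) + 1) * β (i + 1) = a * β i := fun i => by
    simp only [hβ]
    rw [Nat.factorial_succ]
    push_cast
    field_simp
    ring
  have hrec : ∀ j : ℕ, ((j : ℝ) + 1) * c (j + 1) =
      (∑ p ∈ Finset.HasAntidiagonal.antidiagonal j, s ^ 2 / (2 * (2 * (p.1 : ℝ) + 1)) * (α p.1 * β p.2)) +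
        a * c j := by
    intro j
    have h1 : ((j : ℝ) + 1) * c (j + 1) =
        (∑ p ∈ Finset.HasAntidiagonal.antidiagonal (j + 1), (p.1 : ℝ) * α p.1 * β p.2) +
        ∑ p ∈ Finset.HasAntidiagonal.antidiagonal (j + 1), α p.1 * ((p.2 : ℝ) * β p.2) := by
      simp only [hcdef]
      rw [Finset.mul_sum, ← Finset.sum_add_distrib]
      refine Finset.sum_congr rfl fun p hp => ?_
      have : (p.1 : ℝ) + p.2 = j + 1 := by exact_mod_cast Finset.HasAntidiagonal.mem_antidiagonal.mp hp
      rw [← this]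
      ring
    rw [h1, Finset.Nat.sum_antidiagonal_succ, Finset.Nat.sum_antidiagonal_succ']
    simp only [hcdef, Nat.cast_zero, zero_mul, mul_zero, zero_add, Nat.cast_add,
      Nat.cast_one, hαs, hβs, Finset.mul_sum]
    congr 1 <;> exact Finset.sum_congr rfl fun p _ => by ring
  have hc0 : ∀ j, 0 ≤ c j := fun j =>
    Finset.sum_nonneg fun p _ => mul_nonneg (hα0 _) (hβ0 _)
  have hstep : ∀ j : ℕ, (s ^ 2 / ((2 * j + 1) * (2 * j + 2)) + a / (j + 1)) * c j ≤ c (j + 1) := by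
    intro j
    have h2 : s ^ 2 / (2 * (2 * (j : ℝ) + 1)) * c j ≤
        ∑ p ∈ Finset.HasAntidiagonal.antidiagonal j, s ^ 2 / (2 * (2 * (p.1 : ℝ) + 1)) * (α p.1 * β p.2) := by
      simp only [hcdef]
      rw [Finset.mul_sum]
      refine Finset.sum_le_sum fun p hp => ?_
      have : (p.1 : ℝ) ≤ j := by 
        exact_mod_cast (Nat.le_add_right _ _).trans_eq
          (Finset.HasAntidiagonal.mem_antidiagonal.mp hp)
      have h0 := mul_nonneg (hα0 p.1) (hβ0 p.2)
      gcongr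
    have hj : (0 : ℝ) < j + 1 := by positivity
    refine le_of_mul_le_mul_left ?_ hj
    rw [hrec]
    refine le_trans (le_of_eq ?_) (add_le_add_left h2 _)
    field_simp
  have hprod : ∀ j : ℕ, ∏ l ∈ Finset.range j,
      (s ^ 2 / ((2 * l + 1) * (2 * l + 2)) + a / ((l : ℝ) + 1)) ≤ c j := by
    intro j
    induction j with
    | zero => simp [hcdef, hα, hβ]
    | succ j ih =>
      rw [Finset.prod_range_succ, mul_comm]
      exact (mul_le_mul_of_nonneg_left ih (by positivity)).trans (hstep j)
  have hsum : ∑ j ∈ Finset.range (d + 1), c j ≤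
      (∑ i ∈ Finset.range (d + 1), α i) * ∑ i ∈ Finset.range (d + 1), β i := by
    simp only [hcdef, Finset.Nat.sum_antidiagonal_eq_sum_range_succ (fun i l => α i * β l)]
    rw [Finset.sum_range_diag_flip (d + 1) fun i l => α i * β l, Finset.sum_mul]
    refine Finset.sum_le_sum fun i _ => ?_
    rw [← Finset.mul_sum]
    refine mul_le_mul_of_nonneg_left ?_ (hα0 i)
    exact Finset.sum_le_sum_of_subset_of_nonneg
      (Finset.range_subset_range.mpr (Nat.sub_le _ _)) fun i _ _ => hβ0 i
  have hsα : ∑ i ∈ Finset.range (d + 1), α i ≤ Real.exp s := by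
    refine le_trans ?_ (Real.sum_le_exp_of_nonneg hs (2 * d + 1))
    clear * - hs
    induction d with
    | zero => simp [α]
    | succ d ih =>
      rw [Finset.sum_range_succ _ (d + 1), show 2 * (d + 1) + 1 = 2 * d + 1 + 1 + 1 by ring,
        Finset.sum_range_succ _ (2 * d + 1 + 1), Finset.sum_range_succ _ (2 * d + 1)]
      have : 0 ≤ s ^ (2 * d + 1) / ((2 * d + 1).factorial : ℝ) := by positivity
      rw [show 2 * d + 1 + 1 = 2 * (d + 1) by ring]
      linarith [show α (d + 1) = s ^ (2 * (d + 1)) / ((2 * (d + 1)).factorial : ℝ) from rfl]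
  have hsβ : ∑ i ∈ Finset.range (d + 1), β i ≤ Real.exp a := Real.sum_le_exp_of_nonneg ha _
  calc _ ≤ ∑ j ∈ Finset.range (d + 1), c j := Finset.sum_le_sum fun j _ => hprod j
    _ ≤ _ := hsum
    _ ≤ Real.exp s * Real.exp a :=
      mul_le_mul hsα hsβ (Finset.sum_nonneg fun i _ => hβ0 i) (Real.exp_pos _).le
    _ = _ := (Real.exp_add _ _).symm

/-- A polynomial bounded at the integers of `[t, t + n]` is bounded at `0`. -/
theorem abs_eval_zero_le_of_pos (d n t : ℕ) (hd : d ≤ n) (hn : 0 < n) (P : ℝ[X])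
    (hP : P.natDegree ≤ d) (M : ℝ) (hM : 0 < M)
    (hb : ∀ i ≤ n, |P.eval ((t : ℝ) + i)| ≤ M) :
    |P.eval 0| ≤ M * Real.exp (2 * √(2 * (d : ℝ) ^ 2 / n * t) + 2 * (d : ℝ) ^ 2 / n) := by
  obtain ⟨b, hbexp⟩ := exists_newton_expansion d (P.comp (X + C (t : ℝ))) (by
    rwa [natDegree_comp, natDegree_X_add_C, mul_one])
  have hQ : ∀ x : ℝ, P.eval (t + x) =
      ∑ j ∈ Finset.range (d + 1), b j * ∏ l ∈ Finset.range j, (x - l) := fun x => by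
    rw [← hbexp, eval_comp]
    simp [add_comm]
  -- This is the expectation of `P(t + Bin(n, u))`, so it inherits the bound `M` on `[0, 1]` from
  -- the integer points alone.
  set f : ℝ[X] := ∑ j ∈ Finset.range (d + 1),
    C (b j * ∏ l ∈ Finset.range j, ((n : ℝ) - l)) * X ^ j with hf
  have hfdeg : f.natDegree ≤ d := natDegree_sum_le_of_forall_le _ _ fun j hj =>
    (natDegree_C_mul_X_pow_le _ _).trans (Nat.lt_succ_iff.mp (Finset.mem_range.mp hj))
  have hfcoeff : ∀ j ∈ Finset.range (d + 1),
      f.coeff j = b j * ∏ l ∈ Finset.range j, ((n : ℝ) - l) := fun j hj => by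
    simp only [hf, finsetSum_coeff, coeff_C_mul_X_pow]
    rw [Finset.sum_ite_eq, if_pos hj]
  have hfeval : ∀ u : ℝ, f.eval u = ∑ i ∈ Finset.range (n + 1),
      P.eval ((t : ℝ) + i) * ((n.choose i : ℝ) * (u ^ i * (1 - u) ^ (n - i))) := fun u => by
    simp only [hf, eval_finsetSum, eval_mul, eval_C, eval_pow, eval_X, hQ, Finset.sum_mul]
    rw [Finset.sum_comm]
    refine Finset.sum_congr rfl fun j _ => ?_
    rw [mul_assoc, ← sum_choose_mul_descFactorial j n u (1 - u) (by ring), Finset.mul_sum]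
    exact Finset.sum_congr rfl fun i _ => by ring
  have hfb : ∀ u ∈ Set.Icc (0 : ℝ) 1, |f.eval u| ≤ M := by
    intro u hu
    have h1 : (0 : ℝ) ≤ 1 - u := by linarith [hu.2]
    have h0 := hu.1
    have hone := add_pow u (1 - u) n
    rw [add_sub_cancel, one_pow] at hone
    rw [hfeval]
    calc _ ≤ ∑ i ∈ Finset.range (n + 1), M * (u ^ i * (1 - u) ^ (n - i) * (n.choose i : ℝ)) := by
          refine (Finset.abs_sum_le_sum_abs _ _).trans (Finset.sum_le_sum fun i hi => ?_)
          have hw : 0 ≤ u ^ i * (1 - u) ^ (n - i) * (n.choose i : ℝ) := by positivity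
          rw [abs_mul, mul_comm (n.choose i : ℝ), abs_of_nonneg hw]
          exact mul_le_mul_of_nonneg_right
            (hb i (Nat.lt_succ_iff.mp (Finset.mem_range.mp hi))) hw
      _ = M := by rw [← Finset.mul_sum, ← hone, mul_one]
  set a : ℝ := 2 * (d : ℝ) ^ 2 / n with ha
  have hnR : (0 : ℝ) < n := by exact_mod_cast hn
  have ha0 : 0 ≤ a := by positivity
  have hs2 : (2 * √(a * t)) ^ 2 = 4 * (a * t) := by
    rw [mul_pow, Real.sq_sqrt (by positivity)]
    norm_num
  have hterm : ∀ j ∈ Finset.range (d + 1), |b j * ∏ l ∈ Finset.range j, (-(t : ℝ) - l)| ≤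
      M * ∏ l ∈ Finset.range j,
        ((2 * √(a * t)) ^ 2 / ((2 * l + 1) * (2 * l + 2)) + a / ((l : ℝ) + 1)) := by
    intro j hj
    have hjd : j ≤ d := Nat.lt_succ_iff.mp (Finset.mem_range.mp hj)
    have hlt : ∀ l ∈ Finset.range j, (l : ℝ) < d ∧ (d : ℝ) ≤ n := fun l hl =>
      ⟨by exact_mod_cast (Finset.mem_range.mp hl).trans_le hjd, by exact_mod_cast hd⟩
    have hpos : 0 < ∏ l ∈ Finset.range j, ((n : ℝ) - l) :=
      Finset.prod_pos fun l hl => by linarith [(hlt l hl).1, (hlt l hl).2]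
    have hcoef := abs_coeff_le_of_abs_le_on_unit_interval d f hfdeg M hM hfb j
    rw [hfcoeff j hj, abs_mul, abs_of_pos hpos, ← le_div_iff₀ hpos, mul_div_assoc,
      ← Finset.prod_div_distrib] at hcoef
    have habs : |∏ l ∈ Finset.range j, (-(t : ℝ) - l)| = ∏ l ∈ Finset.range j, ((t : ℝ) + l) := by
      rw [Finset.abs_prod]
      refine Finset.prod_congr rfl fun l _ => ?_
      rw [show -(t : ℝ) - l = -(t + l) by ring, abs_neg, abs_of_nonneg (by positivity)]
    rw [abs_mul, habs]
    refine (mul_le_mul_of_nonneg_right hcoef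
      (Finset.prod_nonneg fun l _ => by positivity)).trans ?_
    rw [mul_assoc, ← Finset.prod_mul_distrib]
    refine mul_le_mul_of_nonneg_left (Finset.prod_le_prod (fun l hl => ?_) fun l hl => ?_) hM.le
    · obtain ⟨h1, h2⟩ := hlt l hl
      have : 0 ≤ (d : ℝ) ^ 2 - (l : ℝ) ^ 2 := by
        have : (l : ℝ) ^ 2 ≤ (d : ℝ) ^ 2 := by gcongr
        linarith
      have : 0 ≤ (n : ℝ) - l := by linarith
      positivity
    · obtain ⟨h1, h2⟩ := hlt l hl
      have hl0 : (0 : ℝ) ≤ l := by positivity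
      have hnl : 0 < (n : ℝ) - l := by linarith
      -- Factor `d ^ 2 - l ^ 2`: `d ≤ n` gives `(d - l) / (n - l) ≤ d / n`, and `d + l ≤ 2 * d`.
      have hkey : ((d : ℝ) ^ 2 - (l : ℝ) ^ 2) / (n - l) ≤ a := by
        rw [ha, div_le_div_iff₀ hnl hnR]
        have e1 : ((d : ℝ) - l) * n ≤ d * (n - l) := by nlinarith
        have e2 : (d : ℝ) + l ≤ 2 * d := by linarith
        have e3 : 0 ≤ (d : ℝ) * (n - l) := by positivity
        calc ((d : ℝ) ^ 2 - (l : ℝ) ^ 2) * n = (d + l) * ((d - l) * n) := by ring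
          _ ≤ (d + l) * (d * (n - l)) := by gcongr
          _ ≤ 2 * d * (d * (n - l)) := by gcongr
          _ = _ := by ring
      calc 2 * ((d : ℝ) ^ 2 - (l : ℝ) ^ 2) / ((l + 1) * (2 * l + 1)) / (n - l) * (t + l)
          = ((d : ℝ) ^ 2 - (l : ℝ) ^ 2) / (n - l) * (2 * (t + l) / ((l + 1) * (2 * l + 1))) := by
            field_simp
        _ ≤ a * (2 * (t + l) / ((l + 1) * (2 * l + 1))) := by gcongr
        _ = 4 * (a * t) / ((2 * l + 1) * (2 * l + 2)) +
            a / (l + 1) * ((2 * l) / (2 * l + 1)) := by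
            field_simp
            ring
        _ ≤ 4 * (a * t) / ((2 * l + 1) * (2 * l + 2)) + a / (l + 1) * 1 := by
            gcongr
            rw [div_le_one (by positivity)]
            linarith
        _ = _ := by rw [hs2, mul_one]
  have h0 := hQ (-t)
  rw [add_neg_cancel] at h0
  rw [h0]
  calc _ ≤ _ := Finset.abs_sum_le_sum_abs _ _
    _ ≤ _ := Finset.sum_le_sum hterm
    _ = _ := (Finset.mul_sum _ _ _).symm
    _ ≤ _ := mul_le_mul_of_nonneg_left (sum_prod_le_exp _ a (by positivity) ha0 d) hM.le

/-- Markov's bound is normalised by `M`, so `M = 0` is reached by letting `M'` decrease to `M`. -/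
theorem abs_eval_zero_le (d n t : ℕ) (hd : d ≤ n) (hn : 0 < n) (P : ℝ[X])
    (hP : P.natDegree ≤ d) (M : ℝ) (hM : 0 ≤ M)
    (hb : ∀ i ≤ n, |P.eval ((t : ℝ) + i)| ≤ M) :
    |P.eval 0| ≤ M * Real.exp (2 * √(2 * (d : ℝ) ^ 2 / n * t) + 2 * (d : ℝ) ^ 2 / n) := by
  rw [← div_le_iff₀ (Real.exp_pos _)]
  refine le_of_forall_gt_imp_ge_of_dense fun M' hM' => ?_
  rw [div_le_iff₀ (Real.exp_pos _)]
  exact abs_eval_zero_le_of_pos d n t hd hn P hP M' (hM.trans_lt hM')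
    fun i hi => (hb i hi).trans hM'.le

/-! ### Degree of the amplitudes -/

/-- Functions of a list that are complex polynomials of degree at most `d` in its bits. -/
def lowDegree (N d : ℕ) : Submodule ℂ ((Fin N → Bool) → ℂ) :=
  Submodule.span ℂ {g | ∃ S : Finset (Fin N), S.card ≤ d ∧
    g = fun x => if ∀ i ∈ S, x i = true then 1 else 0}

theorem lowDegree_mono {N d e : ℕ} (h : d ≤ e) : lowDegree N d ≤ lowDegree N e :=
  Submodule.span_mono fun _ ⟨S, hS, hg⟩ => ⟨S, hS.trans h, hg⟩

theorem const_mem_lowDegree (N d : ℕ) (c : ℂ) : (fun _ => c) ∈ lowDegree N d := by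
  have h : (fun _ => 1 : (Fin N → Bool) → ℂ) ∈ lowDegree N d :=
    Submodule.subset_span ⟨∅, by simp, by simp⟩
  convert (lowDegree N d).smul_mem c h using 1
  ext x
  simp

theorem ite_bit_mem_lowDegree {N d : ℕ} {g : (Fin N → Bool) → ℂ} (hg : g ∈ lowDegree N d)
    (i : Fin N) : (fun x => if x i = true then g x else 0) ∈ lowDegree N (d + 1) := by
  induction hg using Submodule.span_induction with
  | mem g hg =>
    obtain ⟨S, hS, rfl⟩ := hg
    refine Submodule.subset_span ⟨insert i S, (Finset.card_insert_le _ _).trans (by omega), ?_⟩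
    ext x
    by_cases h : x i = true <;> simp [h]
  | zero =>
    convert (lowDegree N (d + 1)).zero_mem using 1
    ext x
    simp
  | add f g _ _ hf hg =>
    convert (lowDegree N (d + 1)).add_mem hf hg using 1
    ext x
    by_cases h : x i = true <;> simp [h]
  | smul c g _ hg =>
    convert (lowDegree N (d + 1)).smul_mem c hg using 1
    ext x
    by_cases h : x i = true <;> simp [h]

/-- Branching on a bit is `g + bit * (f - g)`, which costs one degree; positions beyond the list
always take the branch `g`. -/
theorem ite_listBit_mem_lowDegree {N d : ℕ} {f g : (Fin N → Bool) → ℂ} (hf : f ∈ lowDegree N d)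
    (hg : g ∈ lowDegree N d) (j : ℕ) :
    (fun x => if listBit x j = true then f x else g x) ∈ lowDegree N (d + 1) := by
  by_cases hj : j < N
  · have h := ite_bit_mem_lowDegree ((lowDegree N d).sub_mem hf hg) ⟨j, hj⟩
    convert (lowDegree N (d + 1)).add_mem h (lowDegree_mono (Nat.le_succ d) hg) using 1
    ext x
    by_cases hx : x ⟨j, hj⟩ = true <;> simp [listBit, hj, hx]
  · simpa [listBit, hj] using lowDegree_mono (Nat.le_succ d) hg

theorem mulVec_mem_lowDegree {N d : ℕ} {ι : Type*} [Fintype ι] (U : Matrix ι ι ℂ)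
    {ψ : (Fin N → Bool) → ι → ℂ} (h : ∀ k, (fun x => ψ x k) ∈ lowDegree N d) (k : ι) :
    (fun x => U.mulVec (ψ x) k) ∈ lowDegree N d := by
  have h' := (lowDegree N d).sum_mem (t := Finset.univ)
    fun l _ => (lowDegree N d).smul_mem (U k l) (h l)
  convert h' using 1
  ext x
  simp [Matrix.mulVec, dotProduct]

theorem queryGate_mem_lowDegree {N d n w : ℕ} {ψ : (Fin N → Bool) → StateVec n w}
    (h : ∀ k, (fun x => ψ x k) ∈ lowDegree N d) (k : BasisState n w) :
    (fun x => queryGate x (ψ x) k) ∈ lowDegree N (d + 1) := by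
  convert ite_listBit_mem_lowDegree (h (k.1, !k.2.1, k.2.2)) (h k) (k.1 : ℕ) using 1
  ext x
  cases hx : listBit x (k.1 : ℕ) <;> simp [queryGate, hx]

theorem stateAfter_mem_lowDegree {N T : ℕ} (A : QueryNetwork N T) (i : Fin (T + 1)) :
    ∀ k, (fun x => A.stateAfter x i k) ∈ lowDegree N i := by
  induction i using Fin.induction with
  | zero => exact fun k => const_mem_lowDegree _ _ _
  | succ i ih =>
    intro k
    have h := mulVec_mem_lowDegree
      (A.U i.succ : Matrix (BasisState A.n A.w) (BasisState A.n A.w) ℂ)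
      (queryGate_mem_lowDegree ih) k
    simpa [QueryNetwork.stateAfter] using h

/-! ### Conservation of the norm -/

theorem sum_norm_sq_mulVec {ι : Type*} [Fintype ι] [DecidableEq ι] (U : Matrix.unitaryGroup ι ℂ)
    (ψ : ι → ℂ) : ∑ k, ‖(U : Matrix ι ι ℂ).mulVec ψ k‖ ^ 2 = ∑ k, ‖ψ k‖ ^ 2 := by
  have key : ∀ φ : ι → ℂ, ((∑ k, ‖φ k‖ ^ 2 : ℝ) : ℂ) = star φ ⬝ᵥ φ := fun φ => by
    simp [dotProduct, Complex.conj_mul']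
  have hU : star (U : Matrix ι ι ℂ) * U = 1 := Matrix.UnitaryGroup.star_mul_self U
  have h : star ((U : Matrix ι ι ℂ).mulVec ψ) ⬝ᵥ (U : Matrix ι ι ℂ).mulVec ψ = star ψ ⬝ᵥ ψ := by
    rw [Matrix.star_mulVec, ← Matrix.dotProduct_mulVec, Matrix.mulVec_mulVec,
      ← Matrix.star_eq_conjTranspose, hU, Matrix.one_mulVec]
  rw [← key, ← key] at h
  exact_mod_cast h

theorem sum_norm_sq_queryGate {N n w : ℕ} (x : Fin N → Bool) (ψ : StateVec n w) :
    ∑ k, ‖queryGate x ψ k‖ ^ 2 = ∑ k, ‖ψ k‖ ^ 2 := by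
  have hinv : Function.Involutive fun k : BasisState n w =>
      ((k.1, xor k.2.1 (listBit x (k.1 : ℕ)), k.2.2) : BasisState n w) := fun k => by simp
  exact Equiv.sum_comp hinv.toPerm fun k => ‖ψ k‖ ^ 2

theorem sum_norm_sq_stateAfter {N T : ℕ} (A : QueryNetwork N T) (x : Fin N → Bool)
    (i : Fin (T + 1)) : ∑ k, ‖A.stateAfter x i k‖ ^ 2 = 1 := by
  induction i using Fin.induction with
  | zero =>
    simp only [QueryNetwork.stateAfter, Fin.induction_zero]
    rw [sum_norm_sq_mulVec, Finset.sum_eq_single (zeroBasis A.n A.w)]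
    · simp [initState]
    · intro k _ hk
      simp [initState, hk]
    · simp
  | succ i ih =>
    simp only [QueryNetwork.stateAfter, Fin.induction_succ]
    rw [sum_norm_sq_mulVec, sum_norm_sq_queryGate]
    exact ih

/-! ### Symmetrization over lists of equal weight -/

/-- A monomial on `S` therefore averages, over lists of weight `m`, to a ratio of falling factorials
that is a polynomial of degree `S.card` in `m`. The cross-multiplied form also covers `m < S.card`,
where both sides vanish. -/
theorem card_lists_with_ones {N : ℕ} (S : Finset (Fin N)) (m : ℕ) :
    (Finset.univ.filter fun x : Fin N → Bool => numOnes x = m ∧ ∀ i ∈ S, x i = true).card *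
      N.descFactorial S.card = N.choose m * m.descFactorial S.card := by
  rcases lt_or_ge m S.card with hm | hm
  · rw [Nat.descFactorial_of_lt hm, mul_zero, mul_eq_zero, Finset.card_eq_zero]
    left
    refine Finset.filter_eq_empty_iff.mpr fun x _ ⟨h1, h2⟩ => ?_
    have : S ⊆ Finset.univ.filter fun j => x j = true := fun i hi => by simp [h2 i hi]
    have := Finset.card_le_card this
    unfold numOnes at h1
    omega
  · have hcard : (Finset.univ.filter fun x : Fin N → Bool =>
        numOnes x = m ∧ ∀ i ∈ S, x i = true).card = (N - S.card).choose (m - S.card) := by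
      have hc : (Sᶜ).card = N - S.card := by rw [Finset.card_compl, Fintype.card_fin]
      rw [← hc, ← Finset.card_powersetCard]
      refine Finset.card_nbij' (fun x => (Finset.univ.filter fun j => x j = true) \ S)
        (fun A j => decide (j ∈ A ∪ S)) ?_ ?_ ?_ ?_
      · intro x hx
        obtain ⟨h1, h2⟩ := (Finset.mem_filter.mp hx).2
        have hS : S ⊆ Finset.univ.filter fun j => x j = true := fun i hi => by simp [h2 i hi]
        rw [Finset.mem_coe, Finset.mem_powersetCard, Finset.card_sdiff_of_subset hS]
        refine ⟨fun i hi => ?_, by rw [← h1, numOnes]⟩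
        simp at hi ⊢
        exact hi.2
      · intro A hA
        obtain ⟨h1, h2⟩ := Finset.mem_powersetCard.mp (Finset.mem_coe.mp hA)
        have hdis : Disjoint A S := Finset.disjoint_left.mpr fun i hi hiS =>
          Finset.mem_compl.mp (h1 hi) hiS
        refine Finset.mem_coe.mpr (Finset.mem_filter.mpr ⟨Finset.mem_univ _, ?_, ?_⟩)
        · have : (Finset.univ.filter fun j => decide (j ∈ A ∪ S) = true) = A ∪ S := by
            ext; simp
          rw [numOnes, this, Finset.card_union_of_disjoint hdis, h2]
          omega
        · intro i hi
          simp [hi]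
      · intro x hx
        obtain ⟨h1, h2⟩ := (Finset.mem_filter.mp hx).2
        ext j
        by_cases hj : j ∈ S <;> simp [hj, h2]
      · intro A hA
        obtain ⟨h1, h2⟩ := Finset.mem_powersetCard.mp (Finset.mem_coe.mp hA)
        ext j
        have := @h1 j
        simp at this ⊢
        tauto
    rw [hcard]
    rw [Nat.descFactorial_eq_factorial_mul_choose, Nat.descFactorial_eq_factorial_mul_choose]
    rw [mul_left_comm (N.choose m), Nat.choose_mul hm]
    ring

/-- Averaging a polynomial in the bits over all lists with `m` ones gives a polynomial in `m`. -/
theorem exists_symmetrization {N d : ℕ} {g : (Fin N → Bool) → ℂ} (hg : g ∈ lowDegree N d) (c : ℂ) :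
    ∃ P : ℝ[X], P.natDegree ≤ d ∧ ∀ m : ℕ,
      ∑ x : Fin N → Bool with numOnes x = m, (c * g x).re = N.choose m * P.eval (m : ℝ) := by
  -- Taking real parts is only real-linear, so complex scalars are absorbed into the free factor
  -- `c`.
  induction hg using Submodule.span_induction generalizing c with
  | mem g hg =>
    obtain ⟨S, hS, rfl⟩ := hg
    refine ⟨C (c.re / N.descFactorial S.card) * descPochhammer ℝ S.card,
      (natDegree_C_mul_le _ _).trans ?_, fun m => ?_⟩
    · rwa [descPochhammer_natDegree]
    · have hN : (0 : ℝ) < N.descFactorial S.card := by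
        exact_mod_cast Nat.descFactorial_pos.mpr (by simpa using S.card_le_univ)
      have h := card_lists_with_ones S m
      have hR : ((Finset.univ.filter fun x : Fin N → Bool =>
          numOnes x = m ∧ ∀ i ∈ S, x i = true).card : ℝ) * N.descFactorial S.card =
          N.choose m * m.descFactorial S.card := by exact_mod_cast h
      rw [eval_mul, eval_C, descPochhammer_eval_eq_descFactorial]
      have : ∀ x : Fin N → Bool, (c * if ∀ i ∈ S, x i = true then 1 else 0).re =
          if ∀ i ∈ S, x i = true then c.re else 0 := fun x => by split_ifs <;> simp
      simp only [this]
      rw [← Finset.sum_filter, Finset.filter_filter, Finset.sum_const, nsmul_eq_mul]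
      field_simp
      linear_combination c.re * hR
  | zero => exact ⟨0, by simp, by simp⟩
  | add f g _ _ hf hg =>
    obtain ⟨P, hP, hP'⟩ := hf c
    obtain ⟨Q, hQ, hQ'⟩ := hg c
    refine ⟨P + Q, natDegree_add_le_of_degree_le hP hQ, fun m => ?_⟩
    rw [eval_add, mul_add, ← hP', ← hQ', ← Finset.sum_add_distrib]
    simp [mul_add]
  | smul a g _ hg =>
    obtain ⟨P, hP, hP'⟩ := hg (c * a)
    exact ⟨P, hP, fun m => by simp [← hP', mul_assoc]⟩

theorem card_lists_numOnes (N m : ℕ) :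
    (Finset.univ.filter fun x : Fin N → Bool => numOnes x = m).card = N.choose m := by
  simpa using card_lists_with_ones (∅ : Finset (Fin N)) m

theorem numOnes_eq_zero_iff {N : ℕ} (x : Fin N → Bool) : numOnes x = 0 ↔ x = fun _ => false := by
  simp [numOnes, Finset.filter_eq_empty_iff, funext_iff]

/-- If a low-degree function is small in modulus on all lists with at least `t` ones, then it is
not large on the all-zero list. -/
theorem abs_re_le_of_lowDegree {N t T : ℕ} (ht : t < N) (hT : T ≤ N - t)
    {g : (Fin N → Bool) → ℂ} (hg : g ∈ lowDegree N T) {M : ℝ} (hM : 0 ≤ M)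
    (hb : ∀ x, t ≤ numOnes x → ‖g x‖ ≤ M) :
    |(g fun _ => false).re| ≤ M * Real.exp (2 * √(2 * (T : ℝ) ^ 2 / (N - t : ℕ) * t) +
      2 * (T : ℝ) ^ 2 / (N - t : ℕ)) := by
  obtain ⟨P, hP, hsum⟩ := exists_symmetrization hg 1
  simp only [one_mul] at hsum
  have h0 : P.eval 0 = (g fun _ => false).re := by
    have h := hsum 0
    have hset : (Finset.univ.filter fun x : Fin N → Bool => numOnes x = 0) = {fun _ => false} := by
      ext x
      simp [numOnes_eq_zero_iff]
    rw [hset] at h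
    simpa using h.symm
  rw [← h0]
  refine abs_eval_zero_le T (N - t) t hT (by omega) P hP M hM fun i hi => ?_
  have hc : (0 : ℝ) < N.choose (t + i) := by
    exact_mod_cast Nat.choose_pos (by omega)
  have h := hsum (t + i)
  rw [Nat.cast_add] at h
  refine le_of_mul_le_mul_left ?_ hc
  calc (N.choose (t + i) : ℝ) * |P.eval ((t : ℝ) + i)|
      = |∑ x : Fin N → Bool with numOnes x = t + i, (g x).re| := by
        rw [h, abs_mul, abs_of_pos hc]
    _ ≤ ∑ x : Fin N → Bool with numOnes x = t + i, M := by
        refine (Finset.abs_sum_le_sum_abs _ _).trans (Finset.sum_le_sum fun x hx => ?_)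
        refine (Complex.abs_re_le_norm _).trans (hb x ?_)
        have := (Finset.mem_filter.mp hx).2
        omega
    _ = _ := by rw [Finset.sum_const, nsmul_eq_mul, card_lists_numOnes]

/-! ### From output probabilities to the error bound -/

theorem prob_nonneg {N T : ℕ} (A : QueryNetwork N T) (x : Fin N → Bool)
    (E : BasisState A.n A.w → Prop) : 0 ≤ A.prob x E :=
  Finset.sum_nonneg fun _ _ => by positivity

theorem prob_mono {N T : ℕ} (A : QueryNetwork N T) (x : Fin N → Bool)
    {E F : BasisState A.n A.w → Prop} (h : ∀ k, E k → F k) : A.prob x E ≤ A.prob x F := by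
  refine Finset.sum_le_sum_of_subset_of_nonneg (fun k hk => ?_) fun _ _ _ => by positivity
  simp only [Finset.mem_filter, Finset.mem_univ, true_and] at hk ⊢
  exact h k hk

theorem prob_add_prob_not {N T : ℕ} (A : QueryNetwork N T) (x : Fin N → Bool)
    (E : BasisState A.n A.w → Prop) : A.prob x E + A.prob x (fun k => ¬ E k) = 1 := by
  unfold QueryNetwork.prob
  rw [← sum_norm_sq_stateAfter A x (Fin.last T)]
  convert Finset.sum_filter_add_sum_filter_not Finset.univ E
    (fun k => ‖A.finalState x k‖ ^ 2) using 2
  rfl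

/-- A network that makes an event likely on the all-zero list and unlikely on all lists with at
least `t` ones has a large error. -/
theorem one_sub_le_of_prob {N t T : ℕ} {ε : ℝ} (ht : t < N) (hT : T ≤ N - t)
    (A : QueryNetwork N T) (E : BasisState A.n A.w → Prop)
    (h0 : 1 - ε ≤ A.prob (fun _ => false) E)
    (hb : ∀ x, t ≤ numOnes x → A.prob x E ≤ ε) :
    0 ≤ ε ∧ 1 - ε ≤ ε * Real.exp (4 * (T : ℝ) ^ 2 / ((N : ℝ) - t) +
      8 * T * √((t : ℝ) * N / ((N : ℝ) - t) ^ 2)) := by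
  classical
  -- The all-ones list satisfies the promise because `t < N`, so `ε` dominates a probability.
  have hε : 0 ≤ ε := (prob_nonneg A _ E).trans (hb (fun _ => true) (by simpa [numOnes] using ht.le))
  refine ⟨hε, ?_⟩
  set p := A.prob (fun _ => false) E with hp
  have hp0 : 0 ≤ p := prob_nonneg A _ E
  set F := Finset.univ.filter E with hF
  have hprob : ∀ x, A.prob x E = ∑ k ∈ F, ‖A.finalState x k‖ ^ 2 := fun x => by
    unfold QueryNetwork.prob
    rw [hF]
  set g : (Fin N → Bool) → ℂ := fun x =>
    ∑ k ∈ F, star (A.finalState (fun _ => false) k) * A.finalState x k with hgdef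
  have hg : g ∈ lowDegree N T := by
    have h := (lowDegree N T).sum_mem (t := F) fun k _ =>
      (lowDegree N T).smul_mem (star (A.finalState (fun _ => false) k))
        (stateAfter_mem_lowDegree A (Fin.last T) k)
    convert h using 1
    ext x
    simp [hgdef, QueryNetwork.finalState]
  have hg0 : (g fun _ => false).re = p := by
    have : g (fun _ => false) = ((p : ℝ) : ℂ) := by
      rw [hp, hprob]
      simp [hgdef, Complex.conj_mul']
    rw [this, Complex.ofReal_re]
  have hgb : ∀ x, t ≤ numOnes x → ‖g x‖ ≤ √(p * ε) := by
    intro x hx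
    calc ‖g x‖ ≤ ∑ k ∈ F, ‖A.finalState (fun _ => false) k‖ * ‖A.finalState x k‖ := by
          refine (norm_sum_le _ _).trans (le_of_eq (Finset.sum_congr rfl fun k _ => ?_))
          rw [norm_mul, norm_star]
      _ ≤ √(∑ k ∈ F, ‖A.finalState (fun _ => false) k‖ ^ 2) *
          √(∑ k ∈ F, ‖A.finalState x k‖ ^ 2) := Real.sum_mul_le_sqrt_mul_sqrt _ _ _
      _ = √p * √(A.prob x E) := by rw [hp, hprob, hprob]
      _ ≤ √p * √ε := by gcongr; exact hb x hx
      _ = _ := (Real.sqrt_mul hp0 ε).symm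
  have hmain := abs_re_le_of_lowDegree ht hT hg (Real.sqrt_nonneg _) hgb
  rw [hg0, abs_of_nonneg hp0] at hmain
  have hn : ((N - t : ℕ) : ℝ) = (N : ℝ) - t := Nat.cast_sub ht.le
  rw [hn] at hmain
  have hnpos : (0 : ℝ) < (N : ℝ) - t := by
    have : (t : ℝ) < N := by exact_mod_cast ht
    linarith
  set y := 2 * √(2 * (T : ℝ) ^ 2 / ((N : ℝ) - t) * t) + 2 * (T : ℝ) ^ 2 / ((N : ℝ) - t) with hy
  have hsq : p ≤ ε * Real.exp (2 * y) := by
    rcases hp0.eq_or_lt with h | h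
    · rw [← h]
      positivity
    · refine le_of_mul_le_mul_left ?_ h
      calc p * p ≤ (√(p * ε) * Real.exp y) * (√(p * ε) * Real.exp y) :=
            mul_self_le_mul_self hp0 hmain
        _ = (√(p * ε) * √(p * ε)) * (Real.exp y * Real.exp y) := by ring
        _ = p * (ε * Real.exp (2 * y)) := by
            rw [Real.mul_self_sqrt (by positivity), ← Real.exp_add, two_mul]
            ring
  refine (h0.trans hsq).trans (mul_le_mul_of_nonneg_left (Real.exp_le_exp.mpr ?_) hε)
  -- After squaring, the two sides differ by the factor `2 * N / (N - t) ≥ 1`.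
  have hroot : √(2 * (T : ℝ) ^ 2 / ((N : ℝ) - t) * t) ≤
      2 * T * √((t : ℝ) * N / ((N : ℝ) - t) ^ 2) := by
    rw [Real.sqrt_le_left (by positivity), mul_pow, Real.sq_sqrt (by positivity)]
    rw [show (2 * (T : ℝ)) ^ 2 * ((t : ℝ) * N / ((N : ℝ) - t) ^ 2) =
      2 * (T : ℝ) ^ 2 / ((N : ℝ) - t) * t * (2 * N / ((N : ℝ) - t)) by field_simp]
    refine le_mul_of_one_le_right (by positivity) ?_
    rw [le_div_iff₀ hnpos]
    have : (0 : ℝ) ≤ N := by positivity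
    have : (0 : ℝ) ≤ t := by positivity
    linarith
  have : 2 * y = 4 * √(2 * (T : ℝ) ^ 2 / ((N : ℝ) - t) * t) + 4 * (T : ℝ) ^ 2 / ((N : ℝ) - t) := by
    rw [hy]
    ring
  rw [this]
  linarith

/-- In both output models the event "no ones is reported" is likely on the zero list and is an error
on lists with at least `t` ones. -/
theorem one_sub_le_of_achievable {N t T : ℕ} {ε : ℝ} (ht : t < N) (hT : T ≤ N - t)
    (h : DetectionAchievable N t T ε ∨ FindingAchievable N t T ε) :
    0 ≤ ε ∧ 1 - ε ≤ ε * Real.exp (4 * (T : ℝ) ^ 2 / ((N : ℝ) - t) +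
      8 * T * √((t : ℝ) * N / ((N : ℝ) - t) ^ 2)) := by
  have hzero : numOnes (fun _ : Fin N => false) = 0 := (numOnes_eq_zero_iff _).mpr rfl
  rcases h with ⟨A, out, hA⟩ | ⟨A, out, hA⟩
  · refine one_sub_le_of_prob ht hT A (fun k => out k = false) ?_ fun x hx =>
      (prob_mono A x fun k hk => by simp [hk]).trans ((hA x).2 hx)
    have := (hA _).1 hzero
    linarith [prob_add_prob_not A (fun _ => false) fun k => out k = false]
  · refine one_sub_le_of_prob ht hT A (fun k => out k = none) ?_ fun x hx =>
      (prob_mono A x fun k hk => by simp [hk]).trans ((hA x).2 hx)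
    have := (hA _).1 hzero
    linarith [prob_add_prob_not A (fun _ => false) fun k => out k = none]

/-! ### Asymptotic consequence and conclusion -/

/-- The quadratic term contributes `8 * δ`, using `δ ^ 2 ≤ δ`, and the root term `16 * δ`, both from
`N - t ≥ N / 2`. -/
theorem exponent_le {N t T δ : ℝ} (hδ : 0 < δ) (hδ1 : δ ≤ 1) (hN : 0 < N) (ht : 1 ≤ t)
    (htN : t ≤ 1 / 2 * N) (hT : 0 ≤ T) (hTδ : T ≤ δ * √(N / t)) :
    4 * T ^ 2 / (N - t) + 8 * T * √(t * N / (N - t) ^ 2) ≤ 24 * δ := by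
  have hn : N / 2 ≤ N - t := by linarith
  have ht0 : 0 < t := by linarith
  have hroot : √(t * N / (N - t) ^ 2) ≤ 2 * √(t / N) := by
    rw [Real.sqrt_le_left (by positivity), mul_pow, Real.sq_sqrt (by positivity)]
    calc t * N / (N - t) ^ 2 ≤ t * N / (N / 2) ^ 2 := by gcongr
      _ = 2 ^ 2 * (t / N) := by field_simp
  have hprod : √(N / t) * √(t / N) = 1 := by
    rw [← Real.sqrt_mul (by positivity), div_mul_div_cancel₀ ht0.ne', div_self hN.ne',
      Real.sqrt_one]
  have h1 : T * √(t * N / (N - t) ^ 2) ≤ 2 * δ := by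
    calc _ ≤ δ * √(N / t) * (2 * √(t / N)) := by gcongr
      _ = 2 * δ * (√(N / t) * √(t / N)) := by ring
      _ = 2 * δ := by rw [hprod, mul_one]
  have hT2 : T ^ 2 ≤ δ * N := by
    calc T ^ 2 ≤ (δ * √(N / t)) ^ 2 := by gcongr
      _ = δ * (δ * (N / t)) := by rw [mul_pow, Real.sq_sqrt (by positivity)]; ring
      _ ≤ δ * (1 * (N / 1)) := by gcongr
      _ = δ * N := by ring
  have h2 : 4 * T ^ 2 / (N - t) ≤ 8 * δ := by
    rw [div_le_iff₀ (by linarith)]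
    nlinarith
  linarith

end QuantumQuery

theorem mainTheorem5 :
    (∃ b c : ℝ, 0 < b ∧ 0 < c ∧
      ∀ (N t T : ℕ) (ε : ℝ), 1 ≤ t → t < N → T ≤ N - t →
        (QuantumQuery.DetectionAchievable N t T ε ∨ QuantumQuery.FindingAchievable N t T ε) →
        c * Real.exp (-(4 * b * (T : ℝ) ^ 2 / ((N : ℝ) - (t : ℝ)))
          - 8 * (T : ℝ) * Real.sqrt ((t : ℝ) * (N : ℝ) / ((N : ℝ) - (t : ℝ)) ^ 2)) ≤ ε) ∧
    (∀ ε : ℝ, ε < 1 / 2 → ∀ t T : ℕ → ℕ,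
      (∀ᶠ N in atTop, 1 ≤ t N) →
      (fun N : ℕ => (t N : ℝ)) =o[atTop] (fun N : ℕ => (N : ℝ)) →
      (fun N : ℕ => (T N : ℝ)) =o[atTop] (fun N : ℕ => Real.sqrt ((N : ℝ) / (t N : ℝ))) →
      ∀ᶠ N in atTop, ¬ (QuantumQuery.DetectionAchievable N (t N) (T N) ε ∨
        QuantumQuery.FindingAchievable N (t N) (T N) ε)) := by
  -- With exponent `X ≥ 0`, `1 ≤ ε * (1 + exp X) ≤ 2 * ε * exp X`; hence `c = 1 / 2`, and `b = 1`
  -- suffices.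
  refine ⟨⟨1, 1 / 2, one_pos, by norm_num, fun N t T ε _ ht hT h => ?_⟩,
    fun ε hε t T ht1 ht hT => ?_⟩
  · obtain ⟨hε, hmain⟩ := QuantumQuery.one_sub_le_of_achievable ht hT h
    rw [← neg_add', mul_one]
    set X := 4 * (T : ℝ) ^ 2 / ((N : ℝ) - t) + 8 * T * √((t : ℝ) * N / ((N : ℝ) - t) ^ 2) with hX
    have hX0 : 0 ≤ X := by
      have : (0 : ℝ) < (N : ℝ) - t := by
        have : (t : ℝ) < N := by exact_mod_cast ht
        linarith
      positivity
    rw [Real.exp_neg, ← div_eq_mul_inv, div_le_iff₀ (Real.exp_pos _)]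
    have h1 : 1 ≤ Real.exp X := Real.one_le_exp hX0
    nlinarith
  -- Here `y = 1 / 2 - ε`, so `(1 - ε) * (1 - y) - ε = (1 + ε) * (1 / 2 - ε)`, which is positive for
  -- `0 ≤ ε < 1 / 2`. The cap `δ ≤ 1 / 2` makes both `T N` and `t N` at most `N / 2`, as `T N ≤ N -
  -- t N` requires.
  · set y := (1 - 2 * ε) / 2 with hy
    have hy0 : 0 < y := by
      rw [hy]
      linarith
    set δ := min (y / 24) (1 / 2) with hδ
    have hδ0 : 0 < δ := lt_min (by positivity) (by norm_num)
    have hδy : 24 * δ ≤ y := by linarith [min_le_left (y / 24) (1 / 2)]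
    have hδ2 : δ ≤ 1 / 2 := min_le_right _ _
    filter_upwards [ht1, ht.bound (show (0 : ℝ) < 1 / 2 by norm_num), hT.bound hδ0,
      eventually_gt_atTop 0] with N h1 h2 h3 hN h
    rw [Real.norm_natCast, Real.norm_natCast] at h2
    rw [Real.norm_natCast, Real.norm_of_nonneg (Real.sqrt_nonneg _)] at h3
    have hNR : (1 : ℝ) ≤ N := by exact_mod_cast hN
    have htR : (1 : ℝ) ≤ t N := by exact_mod_cast h1
    have htN : t N < N := by
      have : (t N : ℝ) < N := by linarith
      exact_mod_cast this
    have hTN : T N ≤ N - t N := by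
      have hs : √((N : ℝ) / t N) ≤ N := by
        rw [Real.sqrt_le_left (by positivity)]
        calc (N : ℝ) / t N ≤ N / 1 := by gcongr
          _ ≤ N ^ 2 := by nlinarith
      have h4 : (T N : ℝ) ≤ 1 / 2 * N := h3.trans (mul_le_mul hδ2 hs (by positivity) (by norm_num))
      have : (T N : ℝ) + t N ≤ N := by linarith
      have : T N + t N ≤ N := by exact_mod_cast this
      omega
    obtain ⟨hε0, hmain⟩ := QuantumQuery.one_sub_le_of_achievable htN hTN h
    have hexp := (QuantumQuery.exponent_le hδ0 (by linarith) (by linarith) htR h2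
      (by positivity) h3).trans hδy
    have hfin : (1 - ε) * Real.exp (-y) ≤ ε := by
      calc (1 - ε) * Real.exp (-y) ≤ ε * Real.exp y * Real.exp (-y) := by
            refine mul_le_mul_of_nonneg_right (hmain.trans ?_) (Real.exp_pos _).le
            exact mul_le_mul_of_nonneg_left (Real.exp_le_exp.mpr hexp) hε0
        _ = ε := by rw [mul_assoc, ← Real.exp_add, add_neg_cancel, Real.exp_zero, mul_one]
    have hlow := Real.one_sub_le_exp_neg y
    have : (1 - ε) * (1 - y) ≤ ε :=
      (mul_le_mul_of_nonneg_left hlow (by linarith)).trans hfin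
    rw [hy] at this
    nlinarith
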